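/- For a set $X$, words over $X\cup X^{-1}$ have formal inverses $(x_1^{\varepsilon_1}\cdots x_k^{\varepsilon_k})^{-1}=x_k^{-\varepsilon_k}\cdots x_1^{-\varepsilon_1}$. Write $\mathrm{Inv}\langle X\mid R\rangle$ for the quotient of the free monoid $(X\cup X^{-1})^*$ by the congruence generated by all pairs $ww^{-1}w\sim w$ and $vv^{-1}ww^{-1}\sim ww^{-1}vv^{-1}$ together with the relations in $R$, and $\mathrm{Gp}\langle X\mid R\rangle$ for the group with the same presentation. The inverse monoid $M=\mathrm{Inv}\langle X\mid R\rangle$ is $E$-unitary if $\sigma^{-1}(1)$ is exactly the set of idempotents of $M$, where $\sigma\colon M\to\mathrm{Gp}\langle X\mid R\rangle$ is the canonical homomorphism. The Cayley graph of $M$ (or of a group generated by $X$) has an edge from $s$ to $sx$ labelled $x$ for each element $s$ and each $x\in X\cup X^{-1}$. The Schützenberger graphs of $M$ are the strongly connected components of its Cayley graph: the vertices are the elements of one $\mathcal R$-class of $M$ (where $s\mathrel{\mathcal R}s'$ means $sv=s'$ and $s'w=s$ for some $v,w\in M$), and the edges are all edges of the Cayley graph between these vertices. Let $\delta\ge 0$.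 A path is geodesic if no path with the same initial and the same terminal vertex is shorter. A graph is $\delta$-hyperbolic if for every geodesic triangle (three geodesic paths from $x_1$ to $x_2$, from $x_2$ to $x_3$ and from $x_3$ to $x_1$), every vertex on one of the three sides is at path distance at most $\delta$ from a vertex on one of the other two sides. **Theorem.** Let $A$ be a set, $t\notin A$, $m\ge 1$, let $u_1,\dots,u_m\in(A\cup A^{-1})^*$, and let $f\in(A\cup A^{-1}\cup\{t,t^{-1}\})^*$ be an idempotent word, i.e. a word that represents an idempotent of the free inverse monoid $\mathrm{Inv}\langle A,t\mid\ \rangle$. Let $$M=\mathrm{Inv}\langle A,t\mid fu_1=1,\ u_2=1,\ \dots,\ u_m=1\rangle,\qquad H=\mathrm{Gp}\langle A\mid u_1=1,\ \dots,\ u_m=1\rangle,$$ and suppose that every $a\in A$ represents an invertible element of $M$. If $M$ is $E$-unitary and $H$ is $\delta$-hyperbolic, meaning that its Cayley graph with respect to $A$ is $\delta$-hyperbolic, then every Schützenberger graph of $M$ is $\delta$-hyperbolic, with the same $\delta$. -/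

import Mathlib

open scoped NNReal ENNReal

/-! ## Geodesic triangles in directed graphs

A directed (multi)graph is a `Quiver`, a path in it a `Quiver.Path`. -/

namespace GraphMetric

variable {V : Type*} [Quiver V]

/-- The path distance `d(u, v)`: the least length of a path from `u` to `v`
(and `⊤` if there is no such path). -/
noncomputable def pathDist (u v : V) : ℕ∞ :=
  ⨅ p : Quiver.Path u v, (p.length : ℕ∞)

/-- A path is geodesic if its length is the distance between its ends. -/
def IsGeodesic {u v : V} (p : Quiver.Path u v) : Prop :=
  (p.length : ℕ∞) = pathDist u v

/-- Every vertex `y` of the path `p` is at distance at most `δ` from a vertex `z`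
of `q` or of `r`. -/
def SideIsThin (δ : ℝ≥0) {a b c d e f : V}
    (p : Quiver.Path a b) (q : Quiver.Path c d) (r : Quiver.Path e f) : Prop :=
  ∀ y ∈ p.vertices, ∃ z : V, (z ∈ q.vertices ∨ z ∈ r.vertices) ∧
    (pathDist y z : ℝ≥0∞) ≤ (δ : ℝ≥0∞)

variable (V) in
/-- The graph `V` is `δ`-hyperbolic if all its geodesic triangles are `δ`-thin. -/
def IsHyperbolic (δ : ℝ≥0) : Prop :=
  ∀ (x₁ x₂ x₃ : V) (p₁ : Quiver.Path x₁ x₂) (p₂ : Quiver.Path x₂ x₃)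
    (p₃ : Quiver.Path x₃ x₁), IsGeodesic p₁ → IsGeodesic p₂ → IsGeodesic p₃ →
    SideIsThin δ p₁ p₂ p₃ ∧ SideIsThin δ p₂ p₃ p₁ ∧ SideIsThin δ p₃ p₁ p₂

end GraphMetric

/-! ## Cayley graphs and Schützenberger graphs -/

/-- The (right) Cayley graph of the monoid `M` with respect to generators `φ x` labelled by
`x : L`. Its vertices are the elements of `M`. -/
def CayleyGraph {M L : Type*} [Monoid M] (_φ : L → M) : Type _ := M

/-- The edges of the Cayley graph from `s` to `t` are the labels `x` with `s * φ x = t`. -/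
instance CayleyGraph.instQuiver {M L : Type*} [Monoid M] (φ : L → M) :
    Quiver (CayleyGraph φ) where
  Hom := fun (s t : M) => {x : L // s * φ x = t}

/-- Green's relation `𝓡`: `s` and `t` can be right multiplied into each other. -/
def GreenR {M : Type*} [Monoid M] (s t : M) : Prop :=
  (∃ u : M, s * u = t) ∧ ∃ v : M, t * v = s

/-- The Schützenberger graph of `s : M`, that is the strongly connected component of `s` in
the Cayley graph of `M`. Its vertices are the elements of the `𝓡`-class of `s`. -/
def SchutzenbergerGraph {M L : Type*} [Monoid M] (_φ : L → M) (s : M) : Type _ :=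
  {m : M // GreenR s m}

/-- The edges of a Schützenberger graph are all the edges of the Cayley graph between its
vertices. -/
instance SchutzenbergerGraph.instQuiver {M L : Type*} [Monoid M] (φ : L → M) (s : M) :
    Quiver (SchutzenbergerGraph φ s) where
  Hom a b := {x : L // a.1 * φ x = b.1}

/-! ## Presentations -/

/-- Words over `X ∪ X⁻¹`: the letter `(x, true)` is `x`, the letter `(x, false)` is `x⁻¹`. -/
abbrev SignedWord (X : Type*) := FreeMonoid (X × Bool)

namespace SignedWord

/-- The formal inverse `(x₁^ε₁ ⋯ xₙ^εₙ)⁻¹ = xₙ^(-εₙ) ⋯ x₁^(-ε₁)` of a word. -/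
def inverse {X : Type*} (w : SignedWord X) : SignedWord X :=
  FreeMonoid.ofList (FreeGroup.invRev w.toList)

/-- The element of the free group represented by a word. -/
def toFreeGroup {X : Type*} (w : SignedWord X) : FreeGroup X :=
  FreeGroup.mk w.toList

/-- Words over `A ∪ A⁻¹` as words over `A ∪ {t}` and inverses; here `A ∪ {t}` is `Option A`
and `t` is `none`. -/
def embed {A : Type*} (w : SignedWord A) : SignedWord (Option A) :=
  FreeMonoid.map (fun x => (some x.1, x.2)) w

end SignedWord

/-- The set of relations `rᵢ = 1` for a family of words `rᵢ`. -/
def specialRelations {X ι : Type*} (r : ι → SignedWord X) :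
    SignedWord X → SignedWord X → Prop :=
  fun v w => (∃ i, v = r i) ∧ w = 1

/-- The pairs that generate the congruence of the presentation `Inv⟨X | R⟩`: those of the Wagner
congruence, and the relations in `R`. -/
inductive InvRel {X : Type*} (R : SignedWord X → SignedWord X → Prop) :
    SignedWord X → SignedWord X → Prop
  | regular (w : SignedWord X) : InvRel R (w * w.inverse * w) w
  | commute (v w : SignedWord X) :
      InvRel R (v * v.inverse * (w * w.inverse)) (w * w.inverse * (v * v.inverse))
  | relation {v w : SignedWord X} (h : R v w) : InvRel R v w

/-- The inverse monoid `Inv⟨X | R⟩`. -/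
abbrev InvMonoid {X : Type*} (R : SignedWord X → SignedWord X → Prop) : Type _ :=
  (conGen (InvRel R)).Quotient

/-- The element of `Inv⟨X | R⟩` represented by a word. -/
def InvMonoid.ofWord {X : Type*} (R : SignedWord X → SignedWord X → Prop) :
    SignedWord X →* InvMonoid R :=
  (conGen (InvRel R)).mk'

/-- The generators of `Inv⟨X | R⟩` and their inverses, labelled by `X ∪ X⁻¹`. -/
def InvMonoid.letter {X : Type*} (R : SignedWord X → SignedWord X → Prop) (x : X × Bool) :
    InvMonoid R :=
  InvMonoid.ofWord R (FreeMonoid.of x)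

/-- The group `Gp⟨X | R⟩`. -/
abbrev PresGroup {X : Type*} (R : SignedWord X → SignedWord X → Prop) : Type _ :=
  PresentedGroup {g : FreeGroup X | ∃ v w, R v w ∧ g = v.toFreeGroup * w.toFreeGroup⁻¹}

/-- The element of `Gp⟨X | R⟩` represented by a word. -/
def PresGroup.ofWord {X : Type*} (R : SignedWord X → SignedWord X → Prop) :
    SignedWord X →* PresGroup R where
  toFun w := PresentedGroup.mk _ w.toFreeGroup
  map_one' := rfl
  map_mul' _ _ := rfl

/-- The generators of `Gp⟨X | R⟩` and their inverses, labelled by `X ∪ X⁻¹`. -/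
def PresGroup.letter {X : Type*} (R : SignedWord X → SignedWord X → Prop) (x : X × Bool) :
    PresGroup R :=
  PresGroup.ofWord R (FreeMonoid.of x)

theorem PresGroup.ofWord_inverse {X : Type*} (R : SignedWord X → SignedWord X → Prop)
    (w : SignedWord X) : PresGroup.ofWord R w.inverse = (PresGroup.ofWord R w)⁻¹ := rfl

theorem PresGroup.conGen_le_ker {X : Type*} (R : SignedWord X → SignedWord X → Prop) :
    conGen (InvRel R) ≤ Con.ker (PresGroup.ofWord R) := by
  refine Con.conGen_le.2 fun v w h => ?_
  rw [Con.ker_rel]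
  cases h with
  | regular w => simp [PresGroup.ofWord_inverse]
  | commute v w => simp [PresGroup.ofWord_inverse]
  | relation h =>
    have h1 := PresentedGroup.one_of_mem
      (rels := {g : FreeGroup X | ∃ v w, R v w ∧ g = v.toFreeGroup * w.toFreeGroup⁻¹})
      ⟨v, w, h, rfl⟩
    rw [map_mul, map_inv, mul_inv_eq_one] at h1
    exact h1

/-- The canonical homomorphism `σ` from `Inv⟨X | R⟩` onto its greatest group homomorphic image
`Gp⟨X | R⟩`. -/
def InvMonoid.sigma {X : Type*} (R : SignedWord X → SignedWord X → Prop) :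
    InvMonoid R →* PresGroup R :=
  (conGen (InvRel R)).lift (PresGroup.ofWord R) (PresGroup.conGen_le_ker R)

/-- `Inv⟨X | R⟩` is `E`-unitary if `σ⁻¹(1)` is exactly its set of idempotents. -/
def InvMonoid.IsEUnitary {X : Type*} (R : SignedWord X → SignedWord X → Prop) : Prop :=
  InvMonoid.sigma R ⁻¹' {1} = {m : InvMonoid R | IsIdempotentElem m}

/-- A word is an idempotent word if it represents an idempotent of the free inverse monoid. -/
def SignedWord.IsIdempotentWord {X : Type*} (f : SignedWord X) : Prop :=
  IsIdempotentElem (InvMonoid.ofWord (fun _ _ : SignedWord X => False) f)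

/-- The set of relations `f u₁ = 1, u₂ = 1, …, uₘ = 1` over `A ∪ {t}`, where the `uᵢ` are words
over `A ∪ A⁻¹` and `u 0` is the word `u₁`. -/
def twistedRelations {A : Type*} {n : ℕ} (f : SignedWord (Option A))
    (u : Fin (n + 1) → SignedWord A) : SignedWord (Option A) → SignedWord (Option A) → Prop :=
  specialRelations (Fin.cons (f * (u 0).embed) fun i : Fin n => (u i.succ).embed :
    Fin (n + 1) → SignedWord (Option A))

/-!
Write `H = Gp⟨A | uᵢ = 1⟩`. In `M` the element `f` is an idempotent with a right inverse, hence `f = 1`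
and `u₁ = 1`. So `H` maps to the units of `M` (`exists_hom_invMonoid`), and the greatest group image
`G` of `M` is the free product of `H` and the infinite cyclic group on `t` (`exists_hom_presGroup`).
As `M` is `E`-unitary, `σ : M → G` is injective on `𝓡`-classes (`InvMonoid.IsEUnitary.eq_of_greenR`).
A Schützenberger graph is therefore a part of the Cayley graph of `G`, and a union of copies of the
Cayley graph of `H` that are joined to each other, like the vertices of a tree, by edges labelled `t`.

Each vertex `y` lies in one such copy `C`. Sending a vertex to the point at which paths from it
enter `C` gives a projection that is constant on edges outside `C` (`exists_retraction`). Hence a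
geodesic triangle with `y` on a side projects to a geodesic triangle of `C`
(`GraphMetric.Retraction.exists_geodesic_trace`), where hyperbolicity of `H` yields a vertex within
`δ` of `y`. It is on one of the other two sides unless these both miss `C`. In this case all
three corners have the same projection, the side of `y` meets `C` only in `y` and, unless `y` is a
corner, reaches `y` by an edge labelled `t`. This edge is a bridge (`isBridge_of_sigma_eq`), so that
another side passes through `y` as well. The same `δ` works, since inclusions of copies do not
increase distances. The argument about graphs is `GraphMetric.sideIsThin_of_retractions`.

The projection and the bridges come from functions on `G` that are built without normal forms in the
free product: both add up labels along walks in the Cayley graph, and the labels of the edges `t` are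
arbitrary because `t` is free (`exists_cocycle`).
-/

/-! ### Geodesics and vertices of paths -/

namespace GraphMetric

variable {V W : Type*} [Quiver V] [Quiver W]

theorem pathDist_le {a b : V} (p : Quiver.Path a b) : pathDist a b ≤ p.length :=
  iInf_le _ p

theorem isGeodesic_iff {a b : V} {p : Quiver.Path a b} :
    IsGeodesic p ↔ ∀ q : Quiver.Path a b, p.length ≤ q.length := by
  constructor
  · intro h q
    exact_mod_cast h.le.trans (pathDist_le q)
  · intro h
    exact le_antisymm (le_iInf fun q => by exact_mod_cast h q) (pathDist_le p)

theorem isGeodesic_nil (a : V) : IsGeodesic (Quiver.Path.nil : Quiver.Path a a) :=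
  isGeodesic_iff.2 fun q => by simp

theorem length_mapPath (F : W ⥤q V) {a b : W} (q : Quiver.Path a b) :
    (F.mapPath q).length = q.length := by
  induction q with
  | nil => rfl
  | cons q e ih => simp [ih]

theorem pathDist_map_le (F : W ⥤q V) (a b : W) :
    pathDist (F.obj a) (F.obj b) ≤ pathDist a b :=
  le_iInf fun q => (pathDist_le (F.mapPath q)).trans (by rw [length_mapPath])

theorem mem_vertices_comp {a b c : V} (p : Quiver.Path a b) (q : Quiver.Path b c) {x : V} :
    x ∈ (p.comp q).vertices ↔ x ∈ p.vertices ∨ x ∈ q.vertices := by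
  induction q with
  | nil =>
    simp only [Quiver.Path.comp_nil, Quiver.Path.vertices_nil, List.mem_singleton]
    constructor
    · exact Or.inl
    · rintro (h | rfl)
      · exact h
      · exact p.end_mem_vertices
  | cons q e ih => rw [Quiver.Path.comp_cons, Quiver.Path.mem_vertices_cons, ih,
      Quiver.Path.mem_vertices_cons, or_assoc]

/-! ### Retractions onto a copy of a graph, and traces of paths -/

variable (V W) in
/-- A copy of the graph `W` in the graph `V`, with a map `V → W` of the vertices that is left inverse
to the inclusion and constant on every edge outside the copy. So a path from a vertex `v` can enter
the copy only at the image of `proj v`, and `v` is in the copy if and only if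
`incl (proj v) = v`. -/
structure Retraction where
  /-- The inclusion of the copy. -/
  incl : W ⥤q V
  /-- The projection of the vertices. -/
  proj : V → W
  proj_incl : ∀ w, proj (incl.obj w) = w
  edge : ∀ {a b : V}, (a ⟶ b) →
    (incl.obj (proj a) = a ∧ incl.obj (proj b) = b ∧ Nonempty (proj a ⟶ proj b)) ∨
      proj a = proj b

namespace Retraction

variable (ρ : Retraction V W)

/-- A path of `V` either misses the copy of `W`, and then its ends have the same projection, or its
edges in the copy form a path `q` between the projections of its ends. In that case the part of the
path before it first meets the copy, `q`, and the part after it last meets the copy are no longer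
together than the path; `r` and `s` are these parts. -/
theorem exists_trace {a b : V} (p : Quiver.Path a b) :
    (∃ (q : Quiver.Path (ρ.proj a) (ρ.proj b)) (r : Quiver.Path a (ρ.incl.obj (ρ.proj a)))
      (s : Quiver.Path (ρ.incl.obj (ρ.proj b)) b),
      (∀ w, w ∈ q.vertices ↔ ρ.incl.obj w ∈ p.vertices) ∧
        r.length + q.length + s.length ≤ p.length) ∨
    (ρ.proj a = ρ.proj b ∧ ∀ w, ρ.incl.obj w ∉ p.vertices) := by
  have key : ∀ {c : V}, ρ.incl.obj (ρ.proj c) = c → ∀ w, ρ.incl.obj w = c ↔ w = ρ.proj c := by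
    intro c hc w
    constructor
    · intro h
      rw [← ρ.proj_incl w, h]
    · rintro rfl
      exact hc
  -- A path of length zero with prescribed, propositionally equal ends.
  have triv : ∀ {c d : V}, c = d → ∃ r : Quiver.Path c d, r.length = 0 := by
    rintro c _ rfl
    exact ⟨.nil, rfl⟩
  induction p with
  | nil =>
    by_cases ha : ρ.incl.obj (ρ.proj a) = a
    · obtain ⟨r, hr⟩ := triv ha.symm
      obtain ⟨s, hs⟩ := triv ha
      refine Or.inl ⟨.nil, r, s, fun w => ?_, by simp [hr, hs]⟩
      simp [key ha]
    · refine Or.inr ⟨rfl, fun w hw => ha ?_⟩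
      rw [Quiver.Path.vertices_nil, List.mem_singleton] at hw
      rw [← hw, ρ.proj_incl]
  | @cons c d p e ih =>
    rcases ih with ⟨q, r, s, hq, hl⟩ | ⟨hac, hp⟩
    · rcases ρ.edge e with ⟨hc, hd, ⟨e'⟩⟩ | hcd
      · obtain ⟨s', hs'⟩ := triv hd
        refine Or.inl ⟨q.cons e', r, s', fun w => ?_, ?_⟩
        · rw [Quiver.Path.mem_vertices_cons, Quiver.Path.mem_vertices_cons, hq, key hd]
        · simp only [Quiver.Path.length_cons, hs']
          omega
      · have hend := q.end_mem_vertices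
        have : ∃ (q' : Quiver.Path (ρ.proj a) (ρ.proj d))
            (s' : Quiver.Path (ρ.incl.obj (ρ.proj d)) c),
            q'.vertices = q.vertices ∧ q'.length = q.length ∧ s'.length = s.length := by
          rw [← hcd]
          exact ⟨q, s, rfl, rfl, rfl⟩
        obtain ⟨q', s', hv, hl', hs'⟩ := this
        refine Or.inl ⟨q', r, s'.cons e, fun w => ?_, ?_⟩
        · rw [hv, Quiver.Path.mem_vertices_cons, hq]
          refine ⟨Or.inl, ?_⟩
          rintro (h | h)
          · exact h
          · rw [← hq]
            rwa [← ρ.proj_incl w, h, ← hcd]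
        · simp only [Quiver.Path.length_cons, hl', hs']
          omega
    -- The first edge in the copy would start at a vertex of it, so `e` only reaches the copy.
    · rcases ρ.edge e with ⟨hc, -, -⟩ | hcd
      · exact absurd (hc.symm ▸ p.end_mem_vertices) (hp (ρ.proj c))
      · by_cases hd : ρ.incl.obj (ρ.proj d) = d
        · have had := hac.trans hcd
          have : ∃ q : Quiver.Path (ρ.proj a) (ρ.proj d), q.length = 0 ∧
              q.vertices = [ρ.proj d] := by
            rw [had]
            exact ⟨.nil, rfl, rfl⟩
          obtain ⟨q, hq0, hq⟩ := this
          have : ∃ r : Quiver.Path a (ρ.incl.obj (ρ.proj a)), r.length = p.length + 1 := by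
            rw [had, hd]
            exact ⟨p.cons e, rfl⟩
          obtain ⟨r, hr⟩ := this
          obtain ⟨s, hs⟩ := triv hd
          refine Or.inl ⟨q, r, s, fun w => ?_, ?_⟩
          · rw [hq, List.mem_singleton, Quiver.Path.mem_vertices_cons, key hd]
            simp [hp w]
          · simp [hq0, hr, hs]
        · refine Or.inr ⟨hac.trans hcd, fun w hw => ?_⟩
          rw [Quiver.Path.mem_vertices_cons] at hw
          rcases hw with hw | hw
          · exact hp w hw
          · exact hd (by rw [← hw, ρ.proj_incl])

/-- The trace of a geodesic is a geodesic: a shorter path in `W` could be put in its place. -/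
theorem exists_geodesic_trace {a b : V} {p : Quiver.Path a b} (hp : IsGeodesic p) :
    (∃ q : Quiver.Path (ρ.proj a) (ρ.proj b), IsGeodesic q ∧
      ∀ w, w ∈ q.vertices ↔ ρ.incl.obj w ∈ p.vertices) ∨
    (ρ.proj a = ρ.proj b ∧ ∀ w, ρ.incl.obj w ∉ p.vertices) := by
  refine (ρ.exists_trace p).imp_left ?_
  rintro ⟨q, r, s, hq, hl⟩
  refine ⟨q, isGeodesic_iff.2 fun q' => ?_, hq⟩
  have h := isGeodesic_iff.1 hp ((r.comp (ρ.incl.mapPath q')).comp s)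
  rw [Quiver.Path.length_comp, Quiver.Path.length_comp, length_mapPath] at h
  omega

end Retraction

/-! ### Bridges -/

/-- The vertices `c` and `d` are the ends of a bridge: some set `S` contains exactly one of them,
and edges (in either direction) enter or leave `S` only between `c` and `d`. The existence of an
edge between `c` and `d` is not part of the definition. -/
def IsBridge (c d : V) : Prop :=
  ∃ S : Set V, (c ∈ S ↔ d ∉ S) ∧ ∀ {a b : V}, (a ⟶ b) → (a ∈ S ↔ b ∉ S) →
    (a = c ∧ b = d) ∨ (a = d ∧ b = c)

theorem mem_iff_of_avoids {S : Set V} {x : V}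
    (hS : ∀ {a b : V}, (a ⟶ b) → (a ∈ S ↔ b ∉ S) → a = x ∨ b = x) {a b : V}
    (p : Quiver.Path a b) (hp : x ∉ p.vertices) : a ∈ S ↔ b ∈ S := by
  induction p with
  | nil => rfl
  | @cons c d p e ih =>
    rw [Quiver.Path.mem_vertices_cons, not_or] at hp
    rw [ih hp.1]
    by_contra hne
    rcases hS e (by tauto) with rfl | rfl
    · exact hp.1 p.end_mem_vertices
    · exact hp.2 rfl

/-- A side of a triangle that is geodesic and contains a bridge crosses it only once, so the other
two sides together have to cross it back. -/
theorem IsBridge.mem_or_mem {c y x₁ x₂ x₃ : V} (h : IsBridge c y)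
    {p : Quiver.Path x₁ c} (e : c ⟶ y) {p' : Quiver.Path y x₂}
    (hp : IsGeodesic ((p.cons e).comp p')) (q : Quiver.Path x₂ x₃) (r : Quiver.Path x₃ x₁) :
    y ∈ q.vertices ∨ y ∈ r.vertices := by
  obtain ⟨S, hcy, hS⟩ := h
  rw [isGeodesic_iff] at hp
  have h₁ : y ∉ p.vertices := by
    intro hy
    obtain ⟨s, s', rfl⟩ := p.exists_eq_comp_of_mem_vertices hy
    have := hp (s.comp p')
    simp only [Quiver.Path.length_comp, Quiver.Path.length_cons] at this
    omega
  have h₂ : c ∉ p'.vertices := by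
    intro hc
    obtain ⟨s, s', rfl⟩ := p'.exists_eq_comp_of_mem_vertices hc
    have := hp (p.comp s')
    simp only [Quiver.Path.length_comp, Quiver.Path.length_cons] at this
    omega
  have h₃ := mem_iff_of_avoids (S := S) (x := y) (fun e h => by have := hS e h; tauto) p h₁
  have h₄ := mem_iff_of_avoids (S := S) (x := c) (fun e h => by have := hS e h; tauto) p' h₂
  by_contra hqr
  have h₅ := mem_iff_of_avoids (S := S) (x := y) (fun e h => by have := hS e h; tauto)
    (q.comp r) (by rwa [mem_vertices_comp])
  tauto

/-! ### Hyperbolicity from retractions and bridges -/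

/-- A vertex `y` of a geodesic triangle lies in a copy of `W`, and the traces of the three sides form a
geodesic triangle of `W`, with sides of length zero for those that miss the copy. A vertex of the
latter triangle close to `y` is on one of the other two sides, unless both of these miss the copy;
then the copy meets the side of `y` only in `y`, which is therefore the end of a bridge on it. -/
theorem sideIsThin_of_retractions {δ : ℝ≥0} (hW : IsHyperbolic W δ)
    (hV : ∀ y : V, ∃ ρ : Retraction V W, ρ.incl.obj (ρ.proj y) = y ∧
      ∀ c : V, (c ⟶ y) → ρ.incl.obj (ρ.proj c) = c ∨ IsBridge c y)
    {x₁ x₂ x₃ : V} {p₁ : Quiver.Path x₁ x₂} {p₂ : Quiver.Path x₂ x₃} {p₃ : Quiver.Path x₃ x₁}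
    (h₁ : IsGeodesic p₁) (h₂ : IsGeodesic p₂) (h₃ : IsGeodesic p₃) : SideIsThin δ p₁ p₂ p₃ := by
  intro y hy
  have hself : (y ∈ p₂.vertices ∨ y ∈ p₃.vertices) → ∃ z : V,
      (z ∈ p₂.vertices ∨ z ∈ p₃.vertices) ∧ (pathDist y z : ℝ≥0∞) ≤ (δ : ℝ≥0∞) := by
    intro h
    have h0 : pathDist y y = 0 := le_antisymm (pathDist_le .nil) zero_le
    exact ⟨y, h, by simp [h0]⟩
  obtain ⟨ρ, hρy, hedge⟩ := hV y
  obtain ⟨q₁, hq₁, hm₁⟩ | ⟨-, hm₁⟩ := ρ.exists_geodesic_trace h₁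
  swap
  · exact absurd (hρy.symm ▸ hy) (hm₁ (ρ.proj y))
  have hy₁ : ρ.proj y ∈ q₁.vertices := by rwa [hm₁, hρy]
  -- The conclusion for a triangle in `W` whose sides are traces.
  have finish : ∀ (q₂ : Quiver.Path (ρ.proj x₂) (ρ.proj x₃))
      (q₃ : Quiver.Path (ρ.proj x₃) (ρ.proj x₁)), IsGeodesic q₂ → IsGeodesic q₃ →
      (∀ w, w ∈ q₂.vertices ∨ w ∈ q₃.vertices →
        ρ.incl.obj w ∈ p₂.vertices ∨ ρ.incl.obj w ∈ p₃.vertices) →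
      ∃ z : V, (z ∈ p₂.vertices ∨ z ∈ p₃.vertices) ∧ (pathDist y z : ℝ≥0∞) ≤ (δ : ℝ≥0∞) := by
    intro q₂ q₃ hq₂ hq₃ hsub
    obtain ⟨z, hz, hd⟩ := (hW _ _ _ q₁ q₂ q₃ hq₁ hq₂ hq₃).1 _ hy₁
    refine ⟨ρ.incl.obj z, hsub z hz, le_trans ?_ hd⟩
    have := pathDist_map_le ρ.incl (ρ.proj y) z
    rw [hρy] at this
    exact_mod_cast this
  -- A side that misses the copy of `W` is replaced by a path of length zero.
  have const : ∀ {w w' : W}, w = w' → ∃ q : Quiver.Path w w', IsGeodesic q ∧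
      q.vertices = [w] ∧ q.vertices = [w'] := by
    rintro w _ rfl
    exact ⟨.nil, isGeodesic_nil w, rfl, rfl⟩
  obtain ⟨q₂, hq₂, hm₂⟩ | ⟨hc₂, hm₂⟩ := ρ.exists_geodesic_trace h₂ <;>
  obtain ⟨q₃, hq₃, hm₃⟩ | ⟨hc₃, hm₃⟩ := ρ.exists_geodesic_trace h₃
  · exact finish q₂ q₃ hq₂ hq₃ fun w hw => by rwa [← hm₂, ← hm₃]
  · obtain ⟨q₃, hq₃, hv, -⟩ := const hc₃
    refine finish q₂ q₃ hq₂ hq₃ fun w hw => Or.inl ?_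
    rw [hv, List.mem_singleton] at hw
    rw [← hm₂]
    rcases hw with hw | rfl
    · exact hw
    · exact q₂.end_mem_vertices
  · obtain ⟨q₂, hq₂, -, hv⟩ := const hc₂
    refine finish q₂ q₃ hq₂ hq₃ fun w hw => Or.inr ?_
    rw [hv, List.mem_singleton] at hw
    rw [← hm₃]
    rcases hw with rfl | hw
    · exact q₃.start_mem_vertices
    · exact hw
  · -- Now all three corners have the same projection, so `p₁` meets the copy only in `y`.
    have hq₁0 : ∀ w ∈ q₁.vertices, w = ρ.proj y := by
      obtain ⟨q, -, -, hv⟩ := const (hc₂.trans hc₃).symm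
      have hlen := isGeodesic_iff.1 hq₁ q
      have hq0 := q.vertices_length
      have hl₁ := q₁.vertices_length
      rw [hv, List.length_singleton] at hq0
      obtain ⟨w₀, hw₀⟩ := List.length_eq_one_iff.1 (show q₁.vertices.length = 1 by omega)
      rw [hw₀, List.mem_singleton] at hy₁
      intro w hw
      rwa [hw₀, List.mem_singleton, ← hy₁] at hw
    obtain ⟨p, p', rfl⟩ := p₁.exists_eq_comp_of_mem_vertices hy
    cases p with
    | nil => exact hself (Or.inr p₃.end_mem_vertices)
    | @cons c _ p e =>
      rcases hedge c e with hc | hbr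
      · have hcy : c = y := by
          rw [← hc, ← hρy]
          congr 1
          refine hq₁0 _ ((hm₁ _).2 ?_)
          rw [hc, mem_vertices_comp, Quiver.Path.mem_vertices_cons]
          exact Or.inl (Or.inl p.end_mem_vertices)
        subst hcy
        have := isGeodesic_iff.1 h₁ (p.comp p')
        simp only [Quiver.Path.length_comp, Quiver.Path.length_cons] at this
        omega
      · exact hself (hbr.mem_or_mem e h₁ p₂ p₃)

theorem isHyperbolic_of_retractions {δ : ℝ≥0} (hW : IsHyperbolic W δ)
    (hV : ∀ y : V, ∃ ρ : Retraction V W, ρ.incl.obj (ρ.proj y) = y ∧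
      ∀ c : V, (c ⟶ y) → ρ.incl.obj (ρ.proj c) = c ∨ IsBridge c y) : IsHyperbolic V δ :=
  fun _ _ _ _ _ _ h₁ h₂ h₃ =>
    ⟨sideIsThin_of_retractions hW hV h₁ h₂ h₃, sideIsThin_of_retractions hW hV h₂ h₃ h₁,
      sideIsThin_of_retractions hW hV h₃ h₁ h₂⟩

end GraphMetric

/-! ### Words, and idempotents of inverse monoids given by presentations -/

namespace SignedWord

variable {X : Type*}

@[simp]
theorem inverse_inverse (w : SignedWord X) : w.inverse.inverse = w :=
  FreeGroup.invRev_invRev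

@[simp]
theorem toFreeGroup_mul (v w : SignedWord X) :
    (v * w).toFreeGroup = v.toFreeGroup * w.toFreeGroup := rfl

@[simp]
theorem toFreeGroup_one : (1 : SignedWord X).toFreeGroup = 1 := rfl

@[simp]
theorem toFreeGroup_inverse (w : SignedWord X) : w.inverse.toFreeGroup = w.toFreeGroup⁻¹ := rfl

end SignedWord

namespace InvMonoid

variable {X : Type*} {R : SignedWord X → SignedWord X → Prop}

theorem ofWord_surjective : Function.Surjective (ofWord R) := Con.mk'_surjective

theorem ofWord_eq {v w : SignedWord X} (h : InvRel R v w) : ofWord R v = ofWord R w :=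
  (Con.eq _).2 (ConGen.Rel.of _ _ h)

theorem ofWord_mul_inverse_mul (w : SignedWord X) :
    ofWord R w * ofWord R w.inverse * ofWord R w = ofWord R w := by
  simpa using ofWord_eq (InvRel.regular (R := R) w)

theorem ofWord_mul_inverse_comm (v w : SignedWord X) :
    Commute (ofWord R v * ofWord R v.inverse) (ofWord R w * ofWord R w.inverse) := by
  simpa [Commute, SemiconjBy] using ofWord_eq (InvRel.commute (R := R) v w)

theorem sigma_ofWord (w : SignedWord X) : sigma R (ofWord R w) = PresGroup.ofWord R w := rfl

theorem sigma_letter (x : X × Bool) : sigma R (letter R x) = PresGroup.letter R x := rfl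

/-- With `e = w` idempotent and `i = w⁻¹`, the element `i = (i e) (e i)` is a product of two commuting
idempotents, hence idempotent, and then `e = (e i) (i e)` is equal to it. -/
theorem eq_mul_inverse_of_isIdempotentElem {w : SignedWord X}
    (h : IsIdempotentElem (ofWord R w)) : ofWord R w = ofWord R w * ofWord R w.inverse := by
  have h₁ := ofWord_mul_inverse_mul (R := R) w
  have h₂ := ofWord_mul_inverse_mul (R := R) w.inverse
  have hc := (ofWord_mul_inverse_comm (R := R) w w.inverse).eq
  have hi : ofWord R w * ofWord R w = ofWord R w := h
  rw [SignedWord.inverse_inverse] at h₂ hc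
  set e := ofWord R w
  set i := ofWord R w.inverse
  have h₃ : i = e * i * (i * e) := by
    rw [hc]
    calc i = i * e * i := h₂.symm
      _ = i * (e * e) * i := by rw [hi]
      _ = i * e * (e * i) := by simp only [mul_assoc]
  have hii : i * i = i := by
    calc i * i = (e * i * (i * e)) * (i * e * (e * i)) := by rw [← hc, ← h₃]
      _ = e * i * ((i * e * i) * e) * (e * i) := by simp only [mul_assoc]
      _ = e * i * (i * e) * (e * i) := by rw [h₂]
      _ = i * (e * i) := by rw [← h₃]
      _ = i := by rw [← mul_assoc, h₂]
  have hei : e = i := by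
    calc e = e * i * e := h₁.symm
      _ = e * (i * i) * e := by rw [hii]
      _ = e * i * (i * e) := by simp only [mul_assoc]
      _ = i := h₃.symm
  rw [← hei, hi]

theorem commute_of_isIdempotentElem {d e : InvMonoid R} (hd : IsIdempotentElem d)
    (he : IsIdempotentElem e) : Commute d e := by
  obtain ⟨v, rfl⟩ := ofWord_surjective d
  obtain ⟨w, rfl⟩ := ofWord_surjective e
  rw [eq_mul_inverse_of_isIdempotentElem hd, eq_mul_inverse_of_isIdempotentElem he]
  exact ofWord_mul_inverse_comm v w

/-- In the `E`-unitary case `σ` is injective on `𝓡`-classes: `v⁻¹ w` and `w⁻¹ v` are idempotents if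
`v` and `w` have the same image, and idempotents commute. -/
theorem IsEUnitary.eq_of_greenR (hE : IsEUnitary R) {a b : InvMonoid R}
    (h : GreenR a b) (hσ : sigma R a = sigma R b) : a = b := by
  have idem : ∀ m, sigma R m = 1 → IsIdempotentElem m := by
    intro m hm
    have : m ∈ sigma R ⁻¹' {1} := hm
    rwa [hE] at this
  obtain ⟨⟨x, hx⟩, y, hy⟩ := h
  obtain ⟨v, rfl⟩ := ofWord_surjective a
  obtain ⟨w, rfl⟩ := ofWord_surjective b
  rw [sigma_ofWord, sigma_ofWord] at hσ
  have hd := idem (ofWord R v.inverse * ofWord R w) (by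
    rw [map_mul, sigma_ofWord, sigma_ofWord, PresGroup.ofWord_inverse, hσ, inv_mul_cancel])
  have he := idem (ofWord R w.inverse * ofWord R v) (by
    rw [map_mul, sigma_ofWord, sigma_ofWord, PresGroup.ofWord_inverse, hσ, inv_mul_cancel])
  have h₁ : ofWord R v * (ofWord R v.inverse * ofWord R w) = ofWord R w := by
    rw [← hx, ← mul_assoc, ← mul_assoc, ofWord_mul_inverse_mul]
  have h₂ : ofWord R w * (ofWord R w.inverse * ofWord R v) = ofWord R v := by
    rw [← hy, ← mul_assoc, ← mul_assoc, ofWord_mul_inverse_mul]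
  have hc := commute_of_isIdempotentElem hd he
  set d := ofWord R v.inverse * ofWord R w
  set e := ofWord R w.inverse * ofWord R v
  calc ofWord R v = ofWord R v * d * e := by rw [h₁, h₂]
    _ = ofWord R v * (d * d) * e := by rw [hd.eq]
    _ = ofWord R v * d * (d * e) := by simp only [mul_assoc]
    _ = ofWord R v * d * e * d := by rw [hc.eq]; simp only [mul_assoc]
    _ = ofWord R w := by rw [h₁, h₂, h₁]

theorem isUnit_letter {x : X} (h : IsUnit (letter R (x, true))) (b : Bool) :
    IsUnit (letter R (x, b)) := by
  cases b with
  | true => exact h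
  | false =>
    have h₁ : letter R (x, true) * letter R (x, false) * letter R (x, true) =
        letter R (x, true) := ofWord_mul_inverse_mul (R := R) (FreeMonoid.of (x, true))
    obtain ⟨a, ha⟩ := h
    rw [← ha] at h₁
    have h₂ := (Units.mul_left_inj a).1 (h₁.trans (one_mul _).symm)
    rw [← Units.inv_eq_of_mul_eq_one_right h₂]
    exact a⁻¹.isUnit

theorem letter_mul_letter_not {x : X} (h : IsUnit (letter R (x, true))) (b : Bool) :
    letter R (x, b) * letter R (x, !b) = 1 := by
  have h₁ : letter R (x, b) * letter R (x, !b) * letter R (x, b) =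
        letter R (x, b) := ofWord_mul_inverse_mul (R := R) (FreeMonoid.of (x, b))
  exact (isUnit_letter h b).mul_right_cancel (h₁.trans (one_mul _).symm)

end InvMonoid

theorem SignedWord.IsIdempotentWord.toFreeGroup_eq_one {X : Type*} {f : SignedWord X}
    (hf : f.IsIdempotentWord) : f.toFreeGroup = 1 := by
  let φ : SignedWord X →* FreeGroup X := ⟨⟨SignedWord.toFreeGroup, rfl⟩, fun _ _ => rfl⟩
  have hφ : ∀ w, φ w = w.toFreeGroup := fun _ => rfl
  have hle : conGen (InvRel fun _ _ : SignedWord X => False) ≤ Con.ker φ := by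
    refine Con.conGen_le.2 fun v w h => ?_
    rw [Con.ker_rel]
    cases h with
    | regular w => simp [hφ]
    | commute v w => simp [hφ]
    | relation h => exact h.elim
  exact IsIdempotentElem.iff_eq_one.1 (hf.map (Con.lift _ φ hle))

theorem SignedWord.IsIdempotentWord.isIdempotentElem {X : Type*} {f : SignedWord X}
    (hf : f.IsIdempotentWord) (R : SignedWord X → SignedWord X → Prop) :
    IsIdempotentElem (InvMonoid.ofWord R f) := by
  have hle : conGen (InvRel fun _ _ : SignedWord X => False) ≤ Con.ker (InvMonoid.ofWord R) := by
    refine Con.conGen_le.2 fun v w h => ?_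
    rw [Con.ker_rel]
    cases h with
    | regular w => exact InvMonoid.ofWord_eq (.regular w)
    | commute v w => exact InvMonoid.ofWord_eq (.commute v w)
    | relation h => exact h.elim
  exact hf.map (Con.lift _ (InvMonoid.ofWord R) hle)

namespace PresGroup

variable {X : Type*} {R : SignedWord X → SignedWord X → Prop}

theorem letter_true (x : X) : letter R (x, true) = PresentedGroup.of x := rfl

theorem letter_false (x : X) : letter R (x, false) = (letter R (x, true))⁻¹ := rfl

end PresGroup

/-! ### The presented monoid and its greatest group image -/

section Twisted

variable {A : Type*} {n : ℕ} {u : Fin (n + 1) → SignedWord A} {f : SignedWord (Option A)}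

/-- The relation `f u₁ = 1` splits into `f = 1` and `u₁ = 1`, as `f` is an idempotent with a right
inverse. -/
theorem InvMonoid.ofWord_embed_eq_one (hf : f.IsIdempotentWord) (i : Fin (n + 1)) :
    ofWord (twistedRelations f u) (u i).embed = 1 := by
  set R := twistedRelations f u
  have hrel : ∀ i, ofWord R ((Fin.cons (f * (u 0).embed) fun i : Fin n => (u i.succ).embed :
      Fin (n + 1) → SignedWord (Option A)) i) = 1 := fun i =>
    ofWord_eq (.relation ⟨⟨i, rfl⟩, rfl⟩)
  refine Fin.cases ?_ (fun i => ?_) i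
  · have h := hrel 0
    rw [Fin.cons_zero, map_mul] at h
    have hi : ofWord R f * ofWord R f = ofWord R f := hf.isIdempotentElem R
    have h₁ : ofWord R f = 1 := by
      calc ofWord R f = ofWord R f * (ofWord R f * ofWord R (u 0).embed) := by rw [h, mul_one]
        _ = 1 := by rw [← mul_assoc, hi, h]
    rwa [h₁, one_mul] at h
  · exact hrel i.succ

/-- The group `Gp⟨A | uᵢ = 1⟩` maps to the units of the monoid. -/
theorem exists_hom_invMonoid (hf : f.IsIdempotentWord)
    (hunit : ∀ a : A, IsUnit (InvMonoid.letter (twistedRelations f u) (some a, true))) :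
    ∃ κ : PresGroup (specialRelations u) →* InvMonoid (twistedRelations f u),
      ∀ x, κ (PresGroup.letter _ x) = InvMonoid.letter _ (some x.1, x.2) := by
  set R := twistedRelations f u
  have hlift : ∀ w : SignedWord A, ((FreeGroup.lift fun a => (hunit a).unit) w.toFreeGroup :
      InvMonoid R) = InvMonoid.ofWord R w.embed := by
    intro w
    induction w using FreeMonoid.inductionOn' with
    | one => rfl
    | of_mul x w ih =>
      have : InvMonoid.ofWord R (SignedWord.embed (FreeMonoid.of x * w)) =
          InvMonoid.letter R (some x.1, x.2) * InvMonoid.ofWord R (SignedWord.embed w) := rfl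
      rw [this, SignedWord.toFreeGroup_mul, map_mul, Units.val_mul, ih]
      congr 1
      obtain ⟨a, b | b⟩ := x
      · have h1 : (SignedWord.toFreeGroup (FreeMonoid.of (a, false))) = (FreeGroup.of a)⁻¹ := rfl
        rw [h1, map_inv, FreeGroup.lift_apply_of]
        refine Units.inv_eq_of_mul_eq_one_right ?_
        exact InvMonoid.letter_mul_letter_not (hunit a) true
      · have h1 : (SignedWord.toFreeGroup (FreeMonoid.of (a, true))) = FreeGroup.of a := rfl
        rw [h1, FreeGroup.lift_apply_of]
        rfl
  let κ : PresGroup (specialRelations u) →* (InvMonoid R)ˣ :=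
    PresentedGroup.toGroup (f := fun a => (hunit a).unit) (by
      rintro _ ⟨v, w, ⟨⟨i, rfl⟩, rfl⟩, rfl⟩
      ext
      rw [SignedWord.toFreeGroup_one, inv_one, mul_one, hlift,
        InvMonoid.ofWord_embed_eq_one hf, Units.val_one])
  refine ⟨(Units.coeHom _).comp κ, fun x => ?_⟩
  have := hlift (FreeMonoid.of x)
  exact this

/-- The universal property of the free product: `Gp⟨A, t | f u₁ = 1, uᵢ = 1⟩` is the free product of
`Gp⟨A | uᵢ = 1⟩` and the infinite cyclic group generated by `t`, since `f` is trivial in the free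
group. -/
theorem exists_hom_presGroup {K : Type*} [Group K] (hf : f.IsIdempotentWord)
    (θ : PresGroup (specialRelations u) →* K) (τ : K) :
    ∃ Φ : PresGroup (twistedRelations f u) →* K,
      Φ (PresGroup.letter _ (none, true)) = τ ∧
      ∀ a, Φ (PresGroup.letter _ (some a, true)) = θ (PresGroup.letter _ (a, true)) := by
  let g : Option A → K := fun o => o.elim τ fun a => θ (PresentedGroup.of a)
  have hg : ∀ w : SignedWord A, FreeGroup.lift g w.embed.toFreeGroup =
      θ (PresGroup.ofWord _ w) := by
    intro w
    have : (FreeGroup.lift g).comp (FreeGroup.map some) =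
        θ.comp (PresentedGroup.mk _) := by
      ext a
      simp [g, PresentedGroup.of]
    exact DFunLike.congr_fun this w.toFreeGroup
  have hu : ∀ i, FreeGroup.lift g (u i).embed.toFreeGroup = 1 := by
    intro i
    rw [hg]
    have : PresGroup.ofWord (specialRelations u) (u i) = 1 :=
      PresentedGroup.one_of_mem ⟨u i, 1, ⟨⟨i, rfl⟩, rfl⟩, by simp⟩
    rw [this, map_one]
  refine ⟨PresentedGroup.toGroup (f := g) ?_, ?_, fun a => ?_⟩
  · rintro _ ⟨v, w, ⟨⟨i, rfl⟩, rfl⟩, rfl⟩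
    rw [SignedWord.toFreeGroup_one, inv_one, mul_one]
    refine Fin.cases ?_ (fun i => ?_) i
    · rw [Fin.cons_zero, SignedWord.toFreeGroup_mul, hf.toFreeGroup_eq_one, one_mul, hu]
    · exact hu i.succ
  · rw [PresGroup.letter_true, PresentedGroup.toGroup.of]
    rfl
  · rw [PresGroup.letter_true, PresentedGroup.toGroup.of]
    rfl

/-! ### Cocycles on the free product -/

/-- The action of the group `G` on the functions `G → N` by right translation. -/
def translationAut (G N : Type*) [Group G] [Group N] : G →* MulAut (G → N) where
  toFun g :=
    { toFun := fun F x => F (x * g)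
      invFun := fun F x => F (x * g⁻¹)
      left_inv := fun F => by simp
      right_inv := fun F => by simp
      map_mul' := fun _ _ => rfl }
  map_one' := by ext; simp
  map_mul' g h := by ext; simp [mul_assoc]

theorem translationAut_apply {G N : Type*} [Group G] [Group N] (g : G) (F : G → N) (x : G) :
    translationAut G N g F x = F (x * g) := rfl

/-- Walk in the Cayley graph of `G = H * ⟨t⟩` from the vertex `1` and multiply the labels in `N` of the
steps: `c g h` for the step from `g` to `g h`, where `h` is in `H`, and `τ g` for the step from `g`
to `g t`. If `c` is consistent on each coset of `H`, the product depends only on the end of the walk,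
as `τ` is subject to no condition. Formally, the walk is a homomorphism from `G` to the semidirect
product of `G → N` and `G`. -/
theorem exists_cocycle {N : Type*} [Group N] (hf : f.IsIdempotentWord)
    (j : PresGroup (specialRelations u) →* PresGroup (twistedRelations f u))
    (hj : ∀ a, j (PresGroup.letter _ (a, true)) = PresGroup.letter _ (some a, true))
    (c : PresGroup (twistedRelations f u) → PresGroup (specialRelations u) → N)
    (hc : ∀ g h k, c g (h * k) = c g h * c (g * j h) k)
    (τ : PresGroup (twistedRelations f u) → N) :
    ∃ ρ : PresGroup (twistedRelations f u) → N, ρ 1 = 1 ∧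
      (∀ g h, ρ (g * j h) = ρ g * c g h) ∧
      ∀ g, ρ (g * PresGroup.letter _ (none, true)) = ρ g * τ g := by
  let G := PresGroup (twistedRelations f u)
  let θ : PresGroup (specialRelations u) →* (G → N) ⋊[translationAut G N] G :=
    MonoidHom.mk' (fun h => ⟨fun g => c g h, j h⟩) (by
      intro h k
      ext g
      · exact hc g h k
      · exact map_mul j h k)
  obtain ⟨Φ, hΦt, hΦa⟩ := exists_hom_presGroup hf θ ⟨τ, PresGroup.letter _ (none, true)⟩
  have hright : ∀ g, (Φ g).right = g := by
    have : SemidirectProduct.rightHom.comp Φ = MonoidHom.id G := by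
      refine PresentedGroup.ext fun x => ?_
      cases x with
      | none => exact congrArg SemidirectProduct.right hΦt
      | some a => exact (congrArg SemidirectProduct.right (hΦa a)).trans (hj a)
    exact DFunLike.congr_fun this
  have hΦj : ∀ h, Φ (j h) = θ h := by
    have : Φ.comp j = θ := by
      refine PresentedGroup.ext fun a => ?_
      exact (congrArg Φ (hj a)).trans (hΦa a)
    exact DFunLike.congr_fun this
  have hmul : ∀ g k, (Φ (g * k)).left 1 = (Φ g).left 1 * (Φ k).left g := by
    intro g k
    rw [map_mul, SemidirectProduct.mul_left, Pi.mul_apply, translationAut_apply, hright, one_mul]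
  refine ⟨fun g => (Φ g).left 1, ?_, fun g h => ?_, fun g => ?_⟩
  · change (Φ 1).left 1 = 1
    rw [map_one]
    rfl
  · refine (hmul g (j h)).trans ?_
    rw [hΦj]
    rfl
  · refine (hmul g _).trans ?_
    rw [hΦt]

/-- The projection of the free product onto its factor `H`: the leading syllable if it is in `H`,
and `1` otherwise. It is the cocycle that records the steps taken inside `H`. -/
theorem exists_projection (hf : f.IsIdempotentWord)
    (j : PresGroup (specialRelations u) →* PresGroup (twistedRelations f u))
    (hj : ∀ a, j (PresGroup.letter _ (a, true)) = PresGroup.letter _ (some a, true)) :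
    ∃ π : PresGroup (twistedRelations f u) → PresGroup (specialRelations u),
      (∀ h, π (j h) = h) ∧ (∀ g ∉ j.range, ∀ h, π (g * j h) = π g) ∧
      ∀ g, π (g * PresGroup.letter _ (none, true)) = π g := by
  classical
  obtain ⟨π, h1, hA, ht⟩ := exists_cocycle hf j hj (fun g h => if g ∈ j.range then h else 1)
    (by
      intro g h k
      rw [j.range.mul_mem_cancel_right ⟨h, rfl⟩]
      split_ifs <;> simp) 1
  refine ⟨π, fun h => ?_, fun g hg h => ?_, fun g => ?_⟩
  · have := hA 1 h
    rwa [one_mul, h1, one_mul, if_pos (one_mem _)] at this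
  · rw [hA, if_neg hg, mul_one]
  · rw [ht, Pi.one_apply, mul_one]

/-- The edge from `1` to `t` is a bridge of the Cayley graph of the free product: the parity of the
number of times that a walk from `1` crosses it depends only on the end of the walk. -/
theorem exists_sign (hf : f.IsIdempotentWord)
    (j : PresGroup (specialRelations u) →* PresGroup (twistedRelations f u))
    (hj : ∀ a, j (PresGroup.letter _ (a, true)) = PresGroup.letter _ (some a, true)) :
    ∃ β : PresGroup (twistedRelations f u) → ℤˣ,
      β 1 = 1 ∧ β (PresGroup.letter _ (none, true)) = -1 ∧ (∀ g h, β (g * j h) = β g) ∧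
      ∀ g ≠ 1, β (g * PresGroup.letter _ (none, true)) = β g := by
  classical
  obtain ⟨β, h1, hA, ht⟩ := exists_cocycle hf j hj (fun _ _ => (1 : ℤˣ))
    (fun _ _ _ => (one_mul _).symm) (fun g => if g = 1 then -1 else 1)
  refine ⟨β, h1, ?_, fun g h => by rw [hA, mul_one], fun g hg => by rw [ht, if_neg hg, mul_one]⟩
  have := ht 1
  rwa [one_mul, h1, one_mul, if_pos rfl] at this

end Twisted

/-! ### Schützenberger graphs -/

namespace GreenR

variable {M : Type*} [Monoid M] {a b c : M}

theorem symm (h : GreenR a b) : GreenR b a := And.symm h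

theorem trans (h : GreenR a b) (h' : GreenR b c) : GreenR a c := by
  obtain ⟨⟨u, rfl⟩, v, hv⟩ := h
  obtain ⟨⟨u', rfl⟩, v', hv'⟩ := h'
  exact ⟨⟨u * u', by rw [mul_assoc]⟩, v' * v, by rw [← mul_assoc, hv', hv]⟩

theorem mul_map {H : Type*} [Group H] (κ : H →* M) (a : M) (h : H) : GreenR a (a * κ h) :=
  ⟨⟨κ h, rfl⟩, κ h⁻¹, by rw [mul_assoc, ← map_mul, mul_inv_cancel, map_one, mul_one]⟩

end GreenR

theorem GraphMetric.IsBridge.symm {V : Type*} [Quiver V] {c d : V} (h : IsBridge c d) :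
    IsBridge d c := by
  obtain ⟨S, h₁, h₂⟩ := h
  exact ⟨S, by tauto, fun e he => (h₂ e he).symm⟩

namespace SchutzenbergerGraph

open InvMonoid

variable {X : Type*} {R : SignedWord X → SignedWord X → Prop} {s : InvMonoid R}

theorem eq_of_sigma_eq (hE : IsEUnitary R) {a b : SchutzenbergerGraph (letter R) s}
    (h : sigma R a.1 = sigma R b.1) : a = b :=
  Subtype.ext (hE.eq_of_greenR (a.2.symm.trans b.2) h)

theorem exists_sigma_mul_letter {a b : SchutzenbergerGraph (letter R) s} (e : a ⟶ b) :
    ∃ x, sigma R a.1 * PresGroup.letter R x = sigma R b.1 :=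
  ⟨e.1, by
    rw [← sigma_letter, ← map_mul]
    exact congrArg _ e.2⟩

end SchutzenbergerGraph

section Twisted

open InvMonoid GraphMetric SchutzenbergerGraph

variable {A : Type*} {n : ℕ} {u : Fin (n + 1) → SignedWord A} {f : SignedWord (Option A)}
  {s : InvMonoid (twistedRelations f u)}

/-- Edges labelled `t` are bridges of the Schützenberger graph. Only the vertices of the graph are
compared with the group, so it does not matter whether the graph is a full subgraph of the Cayley
graph of the group. -/
theorem isBridge_of_sigma_eq (hf : f.IsIdempotentWord)
    (hE : IsEUnitary (twistedRelations f u))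
    (j : PresGroup (specialRelations u) →* PresGroup (twistedRelations f u))
    (hj : ∀ x, j (PresGroup.letter _ x) = PresGroup.letter _ (some x.1, x.2))
    {c d : SchutzenbergerGraph (letter (twistedRelations f u)) s}
    (hcd : sigma _ c.1 * PresGroup.letter _ (none, true) = sigma _ d.1) : IsBridge c d := by
  obtain ⟨β, h1, hβt, hβA, hβ⟩ := exists_sign hf j fun a => hj (a, true)
  set t := PresGroup.letter (twistedRelations f u) (none, true)
  set σ := sigma (twistedRelations f u)
  -- An edge `t` at which the function changes is the edge from `c` to `d`.
  have cross : ∀ a b : SchutzenbergerGraph (letter (twistedRelations f u)) s,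
      σ a.1 * t = σ b.1 → β ((σ c.1)⁻¹ * σ b.1) ≠ β ((σ c.1)⁻¹ * σ a.1) → a = c ∧ b = d := by
    intro a b hab hne
    rw [← hab, ← mul_assoc] at hne
    have h := not_imp_comm.1 (hβ _) hne
    have hac : a = c := eq_of_sigma_eq hE (inv_mul_eq_one.1 h).symm
    subst hac
    exact ⟨rfl, eq_of_sigma_eq hE (hab.symm.trans hcd)⟩
  refine ⟨{v | β ((σ c.1)⁻¹ * σ v.1) = 1}, ?_, ?_⟩
  · simp only [Set.mem_ofPred_eq, inv_mul_cancel, h1, ← hcd, inv_mul_cancel_left, hβt]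
    decide
  · intro a b e hab
    obtain ⟨⟨x, ε⟩, hx'⟩ := exists_sigma_mul_letter e
    simp only [Set.mem_ofPred_eq] at hab
    have hne : β ((σ c.1)⁻¹ * σ b.1) ≠ β ((σ c.1)⁻¹ * σ a.1) := by
      intro h
      rw [h] at hab
      tauto
    rcases x with _ | x
    · cases ε with
      | true => exact Or.inl (cross a b hx' hne)
      | false =>
        refine Or.inr (cross b a ?_ hne.symm).symm
        rw [← hx', PresGroup.letter_false, inv_mul_cancel_right]
    · rw [← hx', ← hj (x, ε), ← mul_assoc, hβA] at hne
      exact absurd rfl hne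

/-- The copy of the Cayley graph of `H` at the vertex `y` of a Schützenberger graph has the vertices
`y h` for `h` in `H`. -/
theorem exists_retraction (hf : f.IsIdempotentWord)
    (hunit : ∀ a : A, IsUnit (letter (twistedRelations f u) (some a, true)))
    (hE : IsEUnitary (twistedRelations f u))
    (y : SchutzenbergerGraph (letter (twistedRelations f u)) s) :
    ∃ ρ : Retraction (SchutzenbergerGraph (letter (twistedRelations f u)) s)
        (CayleyGraph (PresGroup.letter (specialRelations u))),
      ρ.incl.obj (ρ.proj y) = y ∧
      ∀ c, (c ⟶ y) → ρ.incl.obj (ρ.proj c) = c ∨ IsBridge c y := by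
  obtain ⟨κ, hκ⟩ := exists_hom_invMonoid hf hunit
  set σ := sigma (twistedRelations f u)
  let j := σ.comp κ
  have hj : ∀ x, j (PresGroup.letter _ x) = PresGroup.letter _ (some x.1, x.2) :=
    fun x => congrArg σ (hκ x)
  obtain ⟨π, hπj, hπA, hπt⟩ := exists_projection hf j fun a => hj (a, true)
  have hstep : ∀ h x, y.1 * κ h * letter _ (some x.1, x.2) =
      y.1 * κ (h * PresGroup.letter _ x) := fun h x => by
    rw [← hκ x, map_mul, mul_assoc]
  let incl : CayleyGraph (PresGroup.letter (specialRelations u)) ⥤q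
      SchutzenbergerGraph (letter (twistedRelations f u)) s :=
    { obj := fun (h : PresGroup _) => ⟨y.1 * κ h, y.2.trans (GreenR.mul_map κ y.1 h)⟩
      map := fun {h h'} e => ⟨(some e.1.1, e.1.2), by
        obtain ⟨x, rfl⟩ := e
        exact hstep h x⟩ }
  let proj : SchutzenbergerGraph (letter (twistedRelations f u)) s →
      CayleyGraph (PresGroup.letter (specialRelations u)) := fun v => π ((σ y.1)⁻¹ * σ v.1)
  have hincl : ∀ v, (σ y.1)⁻¹ * σ v.1 ∈ j.range → incl.obj (proj v) = v := by
    rintro v ⟨h, hh⟩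
    refine eq_of_sigma_eq hE ?_
    change σ (y.1 * κ (π ((σ y.1)⁻¹ * σ v.1))) = σ v.1
    rw [← hh, hπj, map_mul]
    exact eq_inv_mul_iff_mul_eq.1 hh
  refine ⟨⟨incl, proj, ?_, ?_⟩, ?_, ?_⟩
  · intro h
    change π ((σ y.1)⁻¹ * σ (y.1 * κ h)) = h
    rw [map_mul, inv_mul_cancel_left]
    exact hπj h
  · intro a b e
    obtain ⟨⟨x, ε⟩, he⟩ := exists_sigma_mul_letter e
    rcases x with _ | x
    · right
      change π _ = π _
      cases ε with
      | true => rw [← he, ← mul_assoc, hπt]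
      | false =>
        rw [PresGroup.letter_false, mul_inv_eq_iff_eq_mul] at he
        rw [he, ← mul_assoc, hπt]
    · have he' : (σ y.1)⁻¹ * σ b.1 = (σ y.1)⁻¹ * σ a.1 * j (PresGroup.letter _ (x, ε)) := by
        rw [hj, mul_assoc]
        exact congrArg _ he.symm
      by_cases ha : (σ y.1)⁻¹ * σ a.1 ∈ j.range
      · refine Or.inl ⟨hincl a ha, hincl b ?_, ⟨(x, ε), ?_⟩⟩
        · rw [he']
          exact mul_mem ha ⟨_, rfl⟩
        · change π _ * _ = π _
          obtain ⟨h, hh⟩ := ha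
          rw [he', ← hh, ← map_mul, hπj, hπj]
      · right
        change π _ = π _
        rw [he', hπA _ ha]
  · exact hincl y (by rw [inv_mul_cancel]; exact one_mem _)
  · intro c e
    obtain ⟨⟨x, ε⟩, he⟩ := exists_sigma_mul_letter e
    rcases x with _ | x
    · right
      cases ε with
      | true => exact isBridge_of_sigma_eq hf hE j hj he
      | false =>
        refine (isBridge_of_sigma_eq hf hE j hj ?_).symm
        rwa [PresGroup.letter_false, mul_inv_eq_iff_eq_mul, eq_comm] at he
    · refine Or.inl (hincl c ?_)
      rw [← he, ← hj (x, ε), mul_inv_rev, inv_mul_cancel_right]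
      exact inv_mem ⟨_, rfl⟩

end Twisted

theorem theorem5p8 {A : Type*} {n : ℕ} (u : Fin (n + 1) → SignedWord A)
    (f : SignedWord (Option A)) (hf : f.IsIdempotentWord)
    (hunit : ∀ a : A, IsUnit (InvMonoid.letter (twistedRelations f u) (some a, true)))
    (hE : InvMonoid.IsEUnitary (twistedRelations f u))
    (δ : ℝ≥0)
    (hH : GraphMetric.IsHyperbolic
      (CayleyGraph (PresGroup.letter (specialRelations u))) δ)
    (s : InvMonoid (twistedRelations f u)) :
    GraphMetric.IsHyperbolic
      (SchutzenbergerGraph (InvMonoid.letter (twistedRelations f u)) s) δ :=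
  GraphMetric.isHyperbolic_of_retractions hH fun y => exists_retraction hf hunit hE y
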